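/- Let $X$ be a real random variable whose law has a density $p_X$ that is positive on $\mathbb{R}$, even, log-concave, and continuously differentiable on $(0,\infty)$. Let $V$ (the channel noise) be a random variable with $\mathbb{E}[V]=0$ and variance $\sigma_V^2\in(0,\infty)$ such that $V$ and $X$ are conditionally independent given $\operatorname{sgn}(X)$ and $\mathbb{E}[V^2\mid X>0]=\mathbb{E}[V^2\mid X<0]=\sigma_V^2$. Let $P_T>0$, $c>0$ and $\gamma=P_T/\sigma_V^2$. A measurable scheduling policy $f:\mathbb{R}\to\{0,1\}$ determines $U=f(X)$ ($U=1$: transmit) and the regions $\mathcal T_0^f=\{x: f(x)=0\}$, $\mathcal T_{1+}^f=\{x>0: f(x)=1\}$, $\mathcal T_{1-}^f=\{x<0: f(x)=1\}$. Call $f$ admissible if $X$ lies in each of the three regions with positive probability and $$\mathbb{E}[X\mid X\in\mathcal T_{1-}^f]<\mathbb{E}[X\mid X\in\mathcal T_0^f]<\mathbb{E}[X\mid X\in\mathcal T_{1+}^f].$$ If $U=1$, put $S=\operatorname{sgn}(X)$ and $\alpha(S)=\sqrt{P_T/\operatorname{Var}(X\mid U=1,S)}$; the encoder sends $Y=S\,\alpha(S)\,(X-\mathbb{E}[X\mid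 U=1,S])$, and the decoder, which receives $Y+V$ and $S$, forms $$\hat X=S\,\frac{1}{\alpha(S)}\,\frac{\gamma}{\gamma+1}\,(Y+V)+\mathbb{E}[X\mid U=1,S].$$ If $U=0$, then $\hat X=\mathbb{E}[X\mid U=0]$. The cost of $f$ is $J(f)=\mathbb{E}[cU+(X-\hat X)^2]$. For $\beta>0$ let $f_\beta(x)=0$ if $|x|<\beta$ and $f_\beta(x)=1$ otherwise, and let $G_X(\beta)=\mathbb{E}[X\mid X>\beta]-\beta$. Then $J(f)$ is finite for every admissible $f$, every $f_\beta$ with $\beta>0$ is admissible, and there is $\beta^*>0$ such that: (i) $J(f_{\beta^*})\le J(f)$ for every admissible policy $f$, so a symmetric threshold policy is optimal; (ii) $J(f_{\beta^*})<J(f_\beta)$ for every $\beta>0$ with $\beta\ne\beta^*$, so the optimal threshold is unique; (iii) $\beta^*$ is the unique $\beta\ge 0$ with $\beta^2=\dfrac{G_X(\beta)^2}{\gamma+1}+c$. -/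

import Mathlib

open MeasureTheory ProbabilityTheory

namespace RemoteEstimation

noncomputable section

/-- The source density is even, log-concave, has support `ℝ`, and is continuously differentiable
on `(0, ∞)`. (A log-concave function with support `ℝ` is positive everywhere, so log-concavity is
concavity of `log p`.) -/
structure IsSourceDensity (p : ℝ → ℝ) : Prop where
  pos : ∀ x, 0 < p x
  even : ∀ x, p (-x) = p x
  logConcave : ConcaveOn ℝ Set.univ (fun x => Real.log (p x))
  contDiffOn : ContDiffOn ℝ 1 p (Set.Ioi 0)

variable {Ω : Type*} [MeasurableSpace Ω]

/-- `X` is a real random variable whose law has density `p` with respect to Lebesgue measure. -/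
structure HasDensity (μ : Measure Ω) (X : Ω → ℝ) (p : ℝ → ℝ) : Prop where
  measurable : Measurable X
  map_eq : μ.map X = volume.withDensity (fun x => ENNReal.ofReal (p x))

/-- The channel noise `V`: zero mean, finite and nonzero variance; `V` and `X` are independent
conditioned on `sgn X` (a discrete variable; the value `0` has probability zero, and conditioning
on a null event gives the zero measure, for which the condition is void); the noise power does
not depend on the sign of `X`. -/
structure IsChannelNoise (μ : Measure Ω) (X V : Ω → ℝ) : Prop where
  measurable : Measurable V
  memLp : MemLp V 2 μ
  mean_zero : ∫ ω, V ω ∂μ = 0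
  variance_pos : 0 < variance V μ
  condIndep : ∀ s : SignType, IndepFun V X (μ[|{ω | SignType.sign (X ω) = s}])
  cond_power : ∀ s : SignType, s ≠ 0 →
    ∫ ω, V ω ^ 2 ∂(μ[|{ω | SignType.sign (X ω) = s}]) = variance V μ

/-- The non-transmission region of a scheduling policy. -/
def region₀ (f : ℝ → Fin 2) : Set ℝ := {x | f x = 0}

/-- The transmission region on the sign `s`: `{x > 0 | f x = 1}` for `s = 1` and
`{x < 0 | f x = 1}` for `s = -1`. -/
def region₁ (f : ℝ → Fin 2) (s : SignType) : Set ℝ := {x | f x = 1 ∧ SignType.sign x = s}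

/-- The conditional mean `E[X | X ∈ A]`. -/
def regionMean (μ : Measure Ω) (X : Ω → ℝ) (A : Set ℝ) : ℝ :=
  ∫ ω, X ω ∂(μ[|X ⁻¹' A])

/-- The conditional variance `Var(X | X ∈ A)`. -/
def regionVar (μ : Measure Ω) (X : Ω → ℝ) (A : Set ℝ) : ℝ :=
  variance X (μ[|X ⁻¹' A])

/-- The scheduling policies the sensor may apply: the three regions have ordered conditional
means (which, to be defined, need regions of positive probability). -/
structure Admissible (μ : Measure Ω) (X : Ω → ℝ) (f : ℝ → Fin 2) : Prop where
  measurable : Measurable f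
  region₀_pos : 0 < μ (X ⁻¹' region₀ f)
  region_pos_pos : 0 < μ (X ⁻¹' region₁ f 1)
  region_neg_pos : 0 < μ (X ⁻¹' region₁ f (-1))
  mean_neg_lt : regionMean μ X (region₁ f (-1)) < regionMean μ X (region₀ f)
  mean_lt_pos : regionMean μ X (region₀ f) < regionMean μ X (region₁ f 1)

/-- The message from the sensor to the encoder; `none` is the free symbol `ε`. -/
def sensorMessage (f : ℝ → Fin 2) (x : ℝ) : Option ℝ := if f x = 1 then some x else none

/-- The message on the side channel: the sign of the observation, or `ε`. -/
def sideMessage (m : Option ℝ) : Option SignType := m.map SignType.sign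

/-- The signal-to-noise ratio `γ = P_T / σ_V²`. -/
def snr (μ : Measure Ω) (V : Ω → ℝ) (P : ℝ) : ℝ := P / variance V μ

/-- The gain `α(s) = √(P_T / Var(X | U = 1, S = s))`. -/
def gain (μ : Measure Ω) (X : Ω → ℝ) (P : ℝ) (f : ℝ → Fin 2) (s : SignType) : ℝ :=
  Real.sqrt (P / regionVar μ X (region₁ f s))

/-- The piecewise affine encoder. -/
def encoder (μ : Measure Ω) (X : Ω → ℝ) (P : ℝ) (f : ℝ → Fin 2) : Option ℝ → ℝ
  | none => 0
  | some x =>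
      (SignType.sign x : ℝ) * gain μ X P f (SignType.sign x) *
        (x - regionMean μ X (region₁ f (SignType.sign x)))

/-- The piecewise affine decoder: its arguments are the message `y` received from the noisy
channel and the message received from the side channel. -/
def decoder (μ : Measure Ω) (X V : Ω → ℝ) (P : ℝ) (f : ℝ → Fin 2) (y : ℝ) : Option SignType → ℝ
  | none => regionMean μ X (region₀ f)
  | some s =>
      (s : ℝ) * (1 / gain μ X P f s) * (snr μ V P / (snr μ V P + 1)) * y +
        regionMean μ X (region₁ f s)

/-- The estimate of `X`: the encoded message is corrupted by the additive noise `V` and decoded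
together with the side message. -/
def estimate (μ : Measure Ω) (X V : Ω → ℝ) (P : ℝ) (f : ℝ → Fin 2) (ω : Ω) : ℝ :=
  decoder μ X V P f (encoder μ X P f (sensorMessage f (X ω)) + V ω)
    (sideMessage (sensorMessage f (X ω)))

/-- The realized cost `c U + (X - X̂)²`. -/
def stageCost (μ : Measure Ω) (X V : Ω → ℝ) (P c : ℝ) (f : ℝ → Fin 2) (ω : Ω) : ℝ :=
  c * ((f (X ω) : ℕ) : ℝ) + (X ω - estimate μ X V P f ω) ^ 2

/-- The expected cost `J(f)`. -/
def expectedCost (μ : Measure Ω) (X V : Ω → ℝ) (P c : ℝ) (f : ℝ → Fin 2) : ℝ :=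
  ∫ ω, stageCost μ X V P c f ω ∂μ

/-- The symmetric threshold policy: no transmission iff `|x| < β`. -/
def thresholdPolicy (β : ℝ) (x : ℝ) : Fin 2 := if |x| < β then 0 else 1

/-- `G_X(β) = E[X | X > β] - β`. -/
def meanExcess (μ : Measure Ω) (X : Ω → ℝ) (β : ℝ) : ℝ := regionMean μ X (Set.Ioi β) - β

end

end RemoteEstimation

open RemoteEstimation

/-!
Write `τ`, `S`, `Q` for the moments of order 0, 1, 2 of the density over a region, and
`Q - S² / τ` for its *spread* (probability times conditional variance). Conditional independence
kills the cross term between source and noise, and the decoder leaves the fraction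
`a = 1 / (γ + 1)` of the variance on a transmission region (`integral_stageCost_region₁`). So the
cost of a policy with regions `A₀, A₁, A₂` is
`c (τ A₁ + τ A₂) + spread A₀ + a (spread A₁ + spread A₂)` (`Admissible.cost`).

*Symmetric thresholds are optimal* (`exists_thresholdCost_le`). Compare a policy with the symmetric
threshold `w` whose silent interval has the same probability as `A₀`. Both costs are affine in
`a ∈ [0, 1]`, so the cases `a = 0` and `a = 1` suffice.
* `a = 0`: among regions of a given probability, the centred interval has the least second moment
  about any point (`moment_two_centred_le`), by the bathtub principle and unimodality.
* `a = 1`: the total spread is the second moment of `X` minus that of the cell means. As the means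
  are ordered, replacing `A₁` and `A₂` by the tails of the same probabilities spreads out the cell
  means (`sum_sq_div_le`). For two tails, the spread is a convex function of the tail probability
  (`spread_tail_ge`), because its derivative is the square of the mean excess `G`, which is
  nonincreasing by log-concavity (`antitone_excess`); so two equal tails are best. The middle
  interval is treated as for `a = 0`.

*The best threshold* (`exists_optimal_threshold`). The cost of the threshold `b` has derivative
`2 p(b) (b² - c - a G(b)²)`, and the bracket is strictly increasing on `[0, ∞)`, negative at `0`
and eventually positive.
-/

namespace RemoteEstimation

open Set Filter Topology Asymptotics

variable {p : ℝ → ℝ}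

/-! ### Even log-concave densities -/

lemma IsSourceDensity.continuous (hp : IsSourceDensity p) : Continuous p := by
  have h : Continuous (fun x => Real.log (p x)) :=
    continuousOn_univ.1 (hp.logConcave.continuousOn isOpen_univ)
  have h2 : p = fun x => Real.exp (Real.log (p x)) := by
    funext x; rw [Real.exp_log (hp.pos x)]
  rw [h2]
  exact Real.continuous_exp.comp h

/-- An even log-concave density is unimodal. -/
lemma IsSourceDensity.le_of_abs_le (hp : IsSourceDensity p) {x y : ℝ} (h : |x| ≤ |y|) :
    p y ≤ p x := by
  have h1 : x ∈ Icc (-|y|) |y| := abs_le.1 h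
  have h2 := hp.logConcave.min_le_of_mem_Icc (mem_univ (-|y|)) (mem_univ |y|) h1
  have h3 : p |y| = p y := by
    rcases abs_choice y with h | h <;> rw [h]
    exact hp.even y
  simp only [hp.even, h3, min_self] at h2
  exact (Real.log_le_log_iff (hp.pos y) (hp.pos x)).1 h2

/-- Log-concavity as a four-point inequality: for `d ≥ 0` the ratio `p (x + d) / p x` is
nonincreasing in `x`. -/
lemma IsSourceDensity.mul_le_mul_shift (hp : IsSourceDensity p) {x y d : ℝ} (hxy : x ≤ y)
    (hd : 0 ≤ d) : p (y + d) * p x ≤ p (x + d) * p y := by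
  rcases hd.eq_or_lt with rfl | hd
  · simp [mul_comm]
  have hL : 0 < y + d - x := by linarith
  have hs : d / (y + d - x) + (y - x) / (y + d - x) = 1 := by field_simp; ring
  have hn1 : 0 ≤ d / (y + d - x) := by positivity
  have hn2 : 0 ≤ (y - x) / (y + d - x) := div_nonneg (by linarith) hL.le
  have h1 := hp.logConcave.2 (mem_univ (y + d)) (mem_univ x) hn1 hn2 hs
  have h2 := hp.logConcave.2 (mem_univ x) (mem_univ (y + d)) hn1 hn2 hs
  simp only [smul_eq_mul] at h1 h2
  have e1 : d / (y + d - x) * (y + d) + (y - x) / (y + d - x) * x = x + d := by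
    field_simp; ring
  have e2 : d / (y + d - x) * x + (y - x) / (y + d - x) * (y + d) = y := by
    field_simp; ring
  rw [e1] at h1
  rw [e2] at h2
  have h3 : Real.log (p (y + d)) + Real.log (p x) ≤ Real.log (p (x + d)) + Real.log (p y) := by
    have e := congrArg (fun r => r * (Real.log (p (y + d)) + Real.log (p x))) hs
    simp only [one_mul] at e
    linarith
  rw [← Real.log_mul (hp.pos _).ne' (hp.pos _).ne', ← Real.log_mul (hp.pos _).ne' (hp.pos _).ne']
    at h3
  exact (Real.log_le_log_iff (mul_pos (hp.pos _) (hp.pos _))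
    (mul_pos (hp.pos _) (hp.pos _))).1 h3

/-- An integrable log-concave density decays at least exponentially. -/
lemma IsSourceDensity.exists_le_exp (hp : IsSourceDensity p) (hi : Integrable p) :
    ∃ b C : ℝ, 0 < b ∧ ∀ x, 0 < x → p x ≤ C * Real.exp (-b * x) := by
  -- Integrability keeps `p` from being constant on `(0, ∞)`.
  obtain ⟨z, hz0, hz⟩ : ∃ z, 0 < z ∧ p z < p 0 := by
    by_contra! hcon
    have hconst : ∀ x ∈ Ioi (0 : ℝ), p x = p 0 := fun x hx =>
      le_antisymm (hp.le_of_abs_le (by simp)) (hcon x hx)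
    have h1 : IntegrableOn (fun _ => p 0) (Ioi (0 : ℝ)) :=
      (hi.integrableOn (s := Ioi 0)).congr_fun hconst measurableSet_Ioi
    rw [integrableOn_const_iff] at h1
    rcases h1 with h1 | h1
    · exact (hp.pos 0).ne' (by simpa using h1)
    · simp at h1
  set b := (Real.log (p 0) - Real.log (p z)) / z with hb
  have hbpos : 0 < b := div_pos (sub_pos.2 (Real.log_lt_log (hp.pos z) hz)) hz0
  refine ⟨b, p 0 * Real.exp (b * z), hbpos, fun x hx => ?_⟩
  rw [mul_assoc, ← Real.exp_add]
  rcases le_total x z with hxz | hxz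
  · have h1 : p x ≤ p 0 := hp.le_of_abs_le (by simp)
    have h2 : 1 ≤ Real.exp (b * z + -b * x) := Real.one_le_exp (by nlinarith)
    nlinarith [hp.pos 0]
  · -- concavity of `log p` at `0 < z ≤ x`
    have hs : (x - z) / x + z / x = 1 := by field_simp; ring
    have h1 := hp.logConcave.2 (mem_univ 0) (mem_univ x)
      (div_nonneg (sub_nonneg.2 hxz) hx.le) (by positivity : 0 ≤ z / x) hs
    have e1 : ((x - z) / x) • (0 : ℝ) + (z / x) • x = z := by
      simp only [smul_eq_mul]; field_simp; ring
    rw [e1] at h1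
    simp only [smul_eq_mul] at h1
    have h2 : Real.log (p x) ≤ Real.log (p 0) - b * x := by
      have h3 : (z / x) * (Real.log (p x) - Real.log (p 0)) ≤ Real.log (p z) - Real.log (p 0) := by
        have e := congrArg (fun r => r * Real.log (p 0)) hs
        simp only [one_mul] at e
        linarith
      have h4 := mul_le_mul_of_nonneg_left h3 (by positivity : 0 ≤ x / z)
      have e2 : x / z * (z / x * (Real.log (p x) - Real.log (p 0))) =
        Real.log (p x) - Real.log (p 0) := by field_simp
      have e3 : x / z * (Real.log (p z) - Real.log (p 0)) = -(b * x) := by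
        rw [hb]; field_simp; ring
      linarith
    have h3 : p x ≤ p 0 * Real.exp (-b * x) := by
      rw [← Real.exp_log (hp.pos x), ← Real.exp_log (hp.pos 0), ← Real.exp_add]
      exact Real.exp_le_exp.2 (by linarith)
    refine h3.trans (mul_le_mul_of_nonneg_left (Real.exp_le_exp.2 ?_) (hp.pos 0).le)
    nlinarith

lemma IsSourceDensity.integrable_pow_mul (hp : IsSourceDensity p) (hi : Integrable p) (k : ℕ) :
    Integrable (fun x => x ^ k * p x) := by
  obtain ⟨b, C, hb, hC⟩ := hp.exists_le_exp hi
  have hcont : Continuous (fun x => x ^ k * p x) := (continuous_pow k).mul hp.continuous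
  have h1 : IntegrableOn (fun x => x ^ k * p x) (Ioi 0) := by
    refine integrable_of_isBigO_exp_neg (half_pos hb) hcont.continuousOn ?_
    have e : (fun x : ℝ => x ^ k * Real.exp (-b * x)) =O[atTop]
        fun x => Real.exp (-(b / 2) * x) := by
      have h := (isLittleO_pow_exp_pos_mul_atTop k (half_pos hb)).isBigO.mul
        (isBigO_refl (fun x : ℝ => Real.exp (-b * x)) atTop)
      refine h.congr_right fun x => ?_
      rw [← Real.exp_add]; congr 1; ring
    refine (IsBigO.of_bound C ?_).trans e
    filter_upwards [eventually_gt_atTop 0] with x hx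
    have h0 : 0 ≤ x ^ k := by positivity
    rw [Real.norm_of_nonneg (mul_nonneg h0 (hp.pos x).le), Real.norm_of_nonneg (by positivity)]
    nlinarith [mul_le_mul_of_nonneg_left (hC x hx) h0]
  have h2 : IntegrableOn (fun x => x ^ k * p x) (Iio 0) := by
    have h3 := (Measure.measurePreserving_neg (volume : Measure ℝ)).integrableOn_comp_preimage
      (Homeomorph.neg ℝ).measurableEmbedding (f := fun x => x ^ k * p x) (s := Ioi 0)
    have h4 := (h3.2 h1).const_mul ((-1) ^ k)
    have e : (Neg.neg ⁻¹' Ioi (0 : ℝ)) = Iio 0 := by ext x; simp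
    rw [e] at h4
    refine h4.congr (ae_of_all _ fun x => ?_)
    simp only [Function.comp_apply, hp.even]
    rw [← mul_assoc, ← mul_pow]; simp
  rw [← integrableOn_univ, ← Iio_union_Ici (a := (0 : ℝ))]
  exact h2.union ((integrableOn_Ici_iff_integrableOn_Ioi).2 h1)

/-! ### Moments of the density over a region -/

/-- The (unnormalized) `k`-th moment of the density `p` over the region `A`. -/
noncomputable def moment (p : ℝ → ℝ) (k : ℕ) (A : Set ℝ) : ℝ := ∫ x in A, x ^ k * p x

lemma moment_union (hp : IsSourceDensity p) (hi : Integrable p) (k : ℕ) {A B : Set ℝ}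
    (hB : MeasurableSet B) (h : Disjoint A B) :
    moment p k (A ∪ B) = moment p k A + moment p k B :=
  setIntegral_union h hB (hp.integrable_pow_mul hi k).integrableOn
    (hp.integrable_pow_mul hi k).integrableOn

lemma integrable_quadratic_mul (hp : IsSourceDensity p) (hi : Integrable p) (r s t : ℝ) :
    Integrable (fun x => (r * x ^ 2 + s * x + t) * p x) := by
  have h := (((hp.integrable_pow_mul hi 2).const_mul r).add
    ((hp.integrable_pow_mul hi 1).const_mul s)).add ((hp.integrable_pow_mul hi 0).const_mul t)
  refine h.congr (ae_of_all _ fun x => ?_)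
  simp only [Pi.add_apply]; ring

lemma setIntegral_quadratic_mul (hp : IsSourceDensity p) (hi : Integrable p) (r s t : ℝ)
    (A : Set ℝ) : ∫ x in A, (r * x ^ 2 + s * x + t) * p x =
      r * moment p 2 A + s * moment p 1 A + t * moment p 0 A := by
  have h2 := ((hp.integrable_pow_mul hi 2).const_mul r).integrableOn (s := A)
  have h1 := ((hp.integrable_pow_mul hi 1).const_mul s).integrableOn (s := A)
  have h0 := ((hp.integrable_pow_mul hi 0).const_mul t).integrableOn (s := A)
  have h21 : IntegrableOn (fun x => r * (x ^ 2 * p x) + s * (x ^ 1 * p x)) A := h2.add h1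
  unfold moment
  rw [← integral_const_mul, ← integral_const_mul, ← integral_const_mul, ← integral_add h2 h1,
    ← integral_add h21 h0]
  congr 1; funext x; ring

/-- The bathtub principle: a set integral is largest over the set where the integrand is
nonnegative. -/
lemma setIntegral_le_of_sign {g : ℝ → ℝ} (hg : Integrable g) {A B : Set ℝ}
    (hA : MeasurableSet A) (hB : MeasurableSet B) (h1 : ∀ x ∈ B, 0 ≤ g x)
    (h2 : ∀ x ∉ B, g x ≤ 0) : ∫ x in A, g x ≤ ∫ x in B, g x := by
  rw [← integral_indicator hA, ← integral_indicator hB]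
  refine integral_mono (hg.indicator hA) (hg.indicator hB) fun x => ?_
  by_cases hxA : x ∈ A <;> by_cases hxB : x ∈ B <;> simp [hxA, hxB]
  · exact h2 x hxB
  · exact h1 x hxB

lemma moment_zero_pos (hp : IsSourceDensity p) (hi : Integrable p) {A : Set ℝ}
    (hA : volume A ≠ 0) : 0 < moment p 0 A := by
  have h : moment p 0 A = ∫ x in A, p x := by simp [moment]
  rw [h, setIntegral_pos_iff_support_of_nonneg_ae (ae_of_all _ fun x => (hp.pos x).le)
    hi.integrableOn]
  have : Function.support p = univ := by ext x; simp [(hp.pos x).ne']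
  rw [this, univ_inter]
  exact pos_iff_ne_zero.2 hA

lemma tail_pos (hp : IsSourceDensity p) (hi : Integrable p) (u : ℝ) : 0 < moment p 0 (Ioi u) :=
  moment_zero_pos hp hi (by simp)

lemma moment_Ici (k : ℕ) (u : ℝ) : moment p k (Ici u) = moment p k (Ioi u) :=
  setIntegral_congr_set Ioi_ae_eq_Ici.symm

lemma moment_Iic_neg (hp : IsSourceDensity p) (k : ℕ) (u : ℝ) :
    moment p k (Iic (-u)) = (-1) ^ k * moment p k (Ioi u) := by
  unfold moment
  rw [← integral_comp_neg_Ioi, ← integral_const_mul]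
  congr 1; funext x
  rw [hp.even, ← mul_assoc, ← mul_pow]; simp

lemma moment_univ_eq (hp : IsSourceDensity p) (hi : Integrable p) (k : ℕ) {u v : ℝ}
    (h : -v ≤ u) : moment p k univ =
      (-1) ^ k * moment p k (Ioi v) + moment p k (Ioc (-v) u) + moment p k (Ioi u) := by
  rw [← moment_Iic_neg hp, ← moment_union hp hi k measurableSet_Ioc, Iic_union_Ioc_eq_Iic h,
    ← moment_union hp hi k measurableSet_Ioi, Iic_union_Ioi]
  · exact Iic_disjoint_Ioi le_rfl
  · exact (Iic_disjoint_Ioi le_rfl).mono_right Ioc_subset_Ioi_self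

lemma moment_one_univ (hp : IsSourceDensity p) (hi : Integrable p) : moment p 1 univ = 0 := by
  rw [moment_univ_eq hp hi 1 (u := 0) (v := 0) (by simp)]
  simp [moment]

lemma hasDerivAt_tail (hp : IsSourceDensity p) (hi : Integrable p) (k : ℕ) (u : ℝ) :
    HasDerivAt (fun u => moment p k (Ioi u)) (-(u ^ k * p u)) u := by
  have hint := hp.integrable_pow_mul hi k
  have hcont : Continuous (fun x => x ^ k * p x) := (continuous_pow k).mul hp.continuous
  have h1 : (fun u => moment p k (Ioi u)) =
      fun u => moment p k (Ioi 0) - ∫ x in (0 : ℝ)..u, x ^ k * p x := by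
    funext u
    have := intervalIntegral.integral_Ioi_sub_Ioi' (hint.integrableOn (s := Ioi 0))
      (hint.integrableOn (s := Ioi u))
    unfold moment
    linarith
  rw [h1]
  exact (hcont.integral_hasStrictDerivAt 0 u).hasDerivAt.const_sub _

lemma tendsto_tail (hp : IsSourceDensity p) (hi : Integrable p) (k : ℕ) :
    Tendsto (fun u => moment p k (Ioi u)) atTop (𝓝 0) := by
  have hint := hp.integrable_pow_mul hi k
  have h := intervalIntegral_tendsto_integral_Ioi 0 (hint.integrableOn (s := Ioi 0)) tendsto_id
  have h2 := (tendsto_const_nhds (x := moment p k (Ioi 0))).sub h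
  have e : ∫ x in Ioi (0 : ℝ), x ^ k * p x = moment p k (Ioi 0) := rfl
  rw [e, sub_self] at h2
  refine h2.congr fun u => ?_
  have := intervalIntegral.integral_Ioi_sub_Ioi' (hint.integrableOn (s := Ioi 0))
    (hint.integrableOn (s := Ioi u))
  simp only [id, moment]
  linarith

lemma strictAnti_tail (hp : IsSourceDensity p) (hi : Integrable p) :
    StrictAnti (fun u => moment p 0 (Ioi u)) := by
  refine strictAnti_of_hasDerivAt_neg (fun u => hasDerivAt_tail hp hi 0 u) fun u => ?_
  simpa using hp.pos u

lemma exists_tail_eq (hp : IsSourceDensity p) (hi : Integrable p) {m : ℝ} (hm : 0 < m)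
    (hm' : m ≤ moment p 0 (Ioi 0)) : ∃ u, 0 ≤ u ∧ moment p 0 (Ioi u) = m := by
  obtain ⟨N, hN⟩ := ((tendsto_tail hp hi 0).eventually_lt_const hm).exists
  have h0N : 0 ≤ N := by
    by_contra! h
    exact absurd ((strictAnti_tail hp hi) h) (by simp only; linarith)
  have hc : ContinuousOn (fun u => moment p 0 (Ioi u)) (Icc 0 N) := fun u _ =>
    (hasDerivAt_tail hp hi 0 u).continuousAt.continuousWithinAt
  obtain ⟨u, hu, hu'⟩ := intermediate_value_Icc' h0N hc ⟨hN.le, hm'⟩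
  exact ⟨u, hu.1, hu'⟩

/-! ### The centred interval minimizes the second moment about any point -/

/-- Among the intervals of a given length, the centred one has the largest probability. -/
lemma integral_interval_le_centred (hp : IsSourceDensity p) (y : ℝ) {t : ℝ} (ht : 0 ≤ t) :
    ∫ x in (y - t)..(y + t), p x ≤ ∫ x in (-t)..t, p x := by
  have hpc := hp.continuous
  have hI : ∀ a b, IntervalIntegrable p volume a b := fun a b =>
    hpc.intervalIntegrable a b
  -- The defect is the integral of `p (s - t) - p (s + t)`, which has the sign of `s`.
  have e1 : (∫ x in (-t)..t, p x) - ∫ x in (y - t)..(y + t), p x =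
      ∫ s in (0 : ℝ)..y, (p (s - t) - p (s + t)) := by
    rw [intervalIntegral.integral_sub
      ((by fun_prop : Continuous fun s => p (s - t)).intervalIntegrable _ _)
      ((by fun_prop : Continuous fun s => p (s + t)).intervalIntegrable _ _),
      intervalIntegral.integral_comp_sub_right, intervalIntegral.integral_comp_add_right,
      zero_sub, zero_add]
    have h1 := intervalIntegral.integral_add_adjacent_intervals (hI (-t) t) (hI t (y + t))
    have h2 := intervalIntegral.integral_add_adjacent_intervals (hI (-t) (y - t))
      (hI (y - t) (y + t))
    linarith
  suffices 0 ≤ ∫ s in (0 : ℝ)..y, (p (s - t) - p (s + t)) by linarith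
  rcases le_total 0 y with hy | hy
  · refine intervalIntegral.integral_nonneg hy fun s hs => sub_nonneg.2 (hp.le_of_abs_le ?_)
    refine sq_le_sq.1 ?_
    nlinarith [mul_nonneg hs.1 ht]
  · rw [intervalIntegral.integral_symm, ← intervalIntegral.integral_neg]
    refine intervalIntegral.integral_nonneg hy fun s hs => ?_
    rw [neg_sub]
    refine sub_nonneg.2 (hp.le_of_abs_le ?_)
    refine sq_le_sq.1 ?_
    nlinarith [mul_nonneg (neg_nonneg.2 hs.2) ht]

lemma hasDerivAt_integral_centred (hp : IsSourceDensity p) (y t : ℝ) :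
    HasDerivAt (fun t => ∫ x in (y - t)..(y + t), p x) (p (y + t) + p (y - t)) t := by
  have hpc := hp.continuous
  have h1 : (fun t => ∫ x in (y - t)..(y + t), p x) =
      fun t => (∫ x in (0 : ℝ)..(y + t), p x) - ∫ x in (0 : ℝ)..(y - t), p x := by
    funext t
    exact (intervalIntegral.integral_interval_sub_left (hpc.intervalIntegrable _ _)
      (hpc.intervalIntegrable _ _)).symm
  rw [h1]
  have h2 := (hpc.integral_hasStrictDerivAt 0 (y + t)).hasDerivAt.comp t
    ((hasDerivAt_id t).const_add y)
  have h3 := (hpc.integral_hasStrictDerivAt 0 (y - t)).hasDerivAt.comp t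
    ((hasDerivAt_id t).const_sub y)
  refine (h2.sub h3).congr_deriv ?_
  ring

/-- Layer-cake form of the integral of the kernel `w² - (x - y)²`. -/
lemma integral_kernel_eq (hp : IsSourceDensity p) (y w : ℝ) :
    ∫ x in (y - w)..(y + w), (w ^ 2 - (x - y) ^ 2) * p x =
      ∫ t in (0 : ℝ)..w, 2 * t * ∫ x in (y - t)..(y + t), p x := by
  have hpc := hp.continuous
  have hker : ∀ t, HasDerivAt (fun t : ℝ => w ^ 2 - t ^ 2) (-(2 * t)) t := by
    intro t
    simpa using (hasDerivAt_pow 2 t).const_sub (w ^ 2)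
  have hparts := intervalIntegral.integral_mul_deriv_eq_deriv_mul (a := 0) (b := w)
    (fun t _ => hker t) (fun t _ => hasDerivAt_integral_centred hp y t)
    ((by fun_prop : Continuous fun t : ℝ => -(2 * t)).intervalIntegrable _ _)
    ((by fun_prop : Continuous fun t : ℝ => p (y + t) + p (y - t)).intervalIntegrable _ _)
  have e0 : ∫ t in (0 : ℝ)..w, (w ^ 2 - t ^ 2) * (p (y + t) + p (y - t)) =
      ∫ x in (y - w)..(y + w), (w ^ 2 - (x - y) ^ 2) * p x := by
    have c0 : Continuous fun x => (w ^ 2 - (x - y) ^ 2) * p x := by fun_prop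
    have a1 := intervalIntegral.integral_comp_add_left (a := 0) (b := w)
      (fun x => (w ^ 2 - (x - y) ^ 2) * p x) y
    have a2 := intervalIntegral.integral_comp_sub_left (a := 0) (b := w)
      (fun x => (w ^ 2 - (x - y) ^ 2) * p x) y
    have a3 := intervalIntegral.integral_add_adjacent_intervals
      (c0.intervalIntegrable (μ := volume) (y - w) y) (c0.intervalIntegrable y (y + w))
    rw [add_zero] at a1
    rw [sub_zero] at a2
    rw [← a3, ← a1, ← a2, add_comm, ← intervalIntegral.integral_add
      ((by fun_prop : Continuous _).intervalIntegrable _ _)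
      ((by fun_prop : Continuous _).intervalIntegrable _ _)]
    congr 1; funext t; ring
  rw [← e0, hparts]
  simp only [sub_self, zero_mul, sub_zero, add_zero, intervalIntegral.integral_same, mul_zero,
    neg_mul, intervalIntegral.integral_neg, sub_neg_eq_add, zero_add]

/-- Among all regions of the probability of `(-w, w]`, the centred interval has the smallest
second moment, even when the second moment of the other region is taken about another point. -/
lemma moment_two_centred_le (hp : IsSourceDensity p) (hi : Integrable p) {w : ℝ} (hw : 0 ≤ w)
    {A : Set ℝ} (hA : MeasurableSet A) (h0 : moment p 0 A = moment p 0 (Ioc (-w) w)) (y : ℝ) :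
    moment p 2 (Ioc (-w) w) ≤ moment p 2 A - 2 * y * moment p 1 A + y ^ 2 * moment p 0 A := by
  -- `w²` is the multiplier of the probability constraint.
  have hbath := setIntegral_le_of_sign (B := Ioc (y - w) (y + w))
    (integrable_quadratic_mul hp hi (-1) (2 * y) (w ^ 2 - y ^ 2)) hA measurableSet_Ioc
    (fun x hx => mul_nonneg (by nlinarith [hx.1, hx.2]) (hp.pos x).le)
    (fun x hx => mul_nonpos_of_nonpos_of_nonneg (by
      by_contra! h
      refine hx ⟨?_, ?_⟩ <;> nlinarith) (hp.pos x).le)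
  rw [setIntegral_quadratic_mul hp hi] at hbath
  have e1 : ∀ z, ∫ x in Ioc (z - w) (z + w), (-1 * x ^ 2 + 2 * z * x + (w ^ 2 - z ^ 2)) * p x =
      ∫ t in (0 : ℝ)..w, 2 * t * ∫ x in (z - t)..(z + t), p x := by
    intro z
    rw [← integral_kernel_eq hp, intervalIntegral.integral_of_le (by linarith)]
    congr 1; funext x; ring
  have hmono : ∫ t in (0 : ℝ)..w, 2 * t * ∫ x in (y - t)..(y + t), p x ≤
      ∫ t in (0 : ℝ)..w, 2 * t * ∫ x in (0 - t)..(0 + t), p x := by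
    have hc : ∀ z, Continuous fun t => 2 * t * ∫ x in (z - t)..(z + t), p x := by
      intro z
      exact (by fun_prop : Continuous fun t : ℝ => 2 * t).mul
        (continuous_iff_continuousAt.2 fun t => (hasDerivAt_integral_centred hp z t).continuousAt)
    refine intervalIntegral.integral_mono_on hw ((hc y).intervalIntegrable _ _)
      ((hc 0).intervalIntegrable _ _) fun t ht => ?_
    refine mul_le_mul_of_nonneg_left ?_ (by linarith [ht.1])
    simpa using integral_interval_le_centred hp y ht.1
  have e2 := setIntegral_quadratic_mul hp hi (-1) (2 * 0) (w ^ 2 - 0 ^ 2) (Ioc (0 - w) (0 + w))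
  rw [e1 0] at e2
  rw [e1 y] at hbath
  simp only [zero_sub, zero_add] at e2 hmono
  rw [h0] at hbath ⊢
  linarith

/-! ### Tails: mean excess and variance -/

/-- The mean excess `E[X | X > u] - u`, in terms of the density of `X`. -/
noncomputable def excess (p : ℝ → ℝ) (u : ℝ) : ℝ :=
  moment p 1 (Ioi u) / moment p 0 (Ioi u) - u

/-- The second central moment of `p` over `A`: probability of `A` times the conditional variance. -/
noncomputable def spread (p : ℝ → ℝ) (A : Set ℝ) : ℝ :=
  moment p 2 A - moment p 1 A ^ 2 / moment p 0 A

lemma spread_pos (hp : IsSourceDensity p) (hi : Integrable p) {A : Set ℝ}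
    (h0 : 0 < moment p 0 A) : 0 < spread p A := by
  have hvol : volume A ≠ 0 := by
    intro h
    rw [moment, setIntegral_measure_zero _ h] at h0
    exact h0.false
  set m := moment p 1 A / moment p 0 A with hm
  have e := setIntegral_quadratic_mul hp hi 1 (-2 * m) (m ^ 2) A
  have e2 : spread p A = ∫ x in A, (1 * x ^ 2 + -2 * m * x + m ^ 2) * p x := by
    rw [e, spread, hm]; field_simp; ring
  rw [e2, setIntegral_pos_iff_support_of_nonneg_ae
    (ae_of_all _ fun x => mul_nonneg (by nlinarith [sq_nonneg (x - m)]) (hp.pos x).le)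
    (integrable_quadratic_mul hp hi _ _ _).integrableOn]
  have hsub : A \ {m} ⊆ Function.support (fun x => (1 * x ^ 2 + -2 * m * x + m ^ 2) * p x) ∩ A := by
    rintro x ⟨hx, hxm⟩
    refine ⟨?_, hx⟩
    rw [Function.mem_support]
    have h1 : 0 < (x - m) ^ 2 := by
      have : x - m ≠ 0 := sub_ne_zero.2 hxm
      positivity
    exact (mul_pos (by linarith) (hp.pos x)).ne'
  refine lt_of_lt_of_le ?_ (measure_mono hsub)
  rw [measure_sdiff_null (by simp)]
  exact pos_iff_ne_zero.2 hvol

lemma excess_pos (hp : IsSourceDensity p) (hi : Integrable p) (u : ℝ) : 0 < excess p u := by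
  have h := setIntegral_quadratic_mul hp hi 0 1 (-u) (Ioi u)
  have hpos : 0 < ∫ x in Ioi u, (0 * x ^ 2 + 1 * x + -u) * p x := by
    rw [setIntegral_pos_iff_support_of_nonneg_ae]
    · refine lt_of_lt_of_le (by simp : 0 < volume (Ioi u)) (measure_mono fun x hx => ⟨?_, hx⟩)
      rw [Function.mem_support]
      exact (mul_pos (by linarith [mem_Ioi.1 hx]) (hp.pos x)).ne'
    · filter_upwards [ae_restrict_mem measurableSet_Ioi] with x hx
      exact mul_nonneg (by linarith [mem_Ioi.1 hx]) (hp.pos x).le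
    · exact (integrable_quadratic_mul hp hi _ _ _).integrableOn
  have h0 := tail_pos hp hi u
  rw [excess, sub_pos, lt_div_iff₀ h0]
  linarith

/-- A log-concave density has nonincreasing mean excess. -/
lemma antitone_excess (hp : IsSourceDensity p) (hi : Integrable p) : Antitone (excess p) := by
  intro u v huv
  set m := u + excess p u with hm
  have hu0 := tail_pos hp hi u
  have hv0 := tail_pos hp hi v
  have hi1 := integrable_quadratic_mul hp hi 0 1 (-m)
  have hi2 := integrable_quadratic_mul hp hi 0 1 (-(m + (v - u)))
  have e1 : ∫ x in Ioi u, (0 * x ^ 2 + 1 * x + -m) * p x = 0 := by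
    rw [setIntegral_quadratic_mul hp hi, hm, excess]
    field_simp; ring
  -- Translate the tail at `v` to the tail at `u`; the quotient of the densities is nonincreasing.
  have e2 : ∫ x in Ioi v, (0 * x ^ 2 + 1 * x + -(m + (v - u))) * p x =
      ∫ x in Ioi u, (x - m) * p (x + (v - u)) := by
    have h := (measurePreserving_add_right (volume : Measure ℝ) (v - u)).setIntegral_preimage_emb
      (measurableEmbedding_addRight (v - u))
      (fun x => (0 * x ^ 2 + 1 * x + -(m + (v - u))) * p x) (Ioi v)
    rw [← h]
    have : (fun x => x + (v - u)) ⁻¹' Ioi v = Ioi u := by ext x; simp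
    rw [this]
    congr 1; funext x; ring
  have hi3 : Integrable (fun x => (x - m) * p (x + (v - u))) := by
    refine (hi2.comp_add_right (v - u)).congr (ae_of_all _ fun x => ?_)
    simp only; ring
  have h3 : p m * ∫ x in Ioi u, (x - m) * p (x + (v - u)) ≤
      p (m + (v - u)) * ∫ x in Ioi u, (0 * x ^ 2 + 1 * x + -m) * p x := by
    rw [← integral_const_mul, ← integral_const_mul]
    refine integral_mono (hi3.const_mul _).integrableOn (hi1.const_mul _).integrableOn fun x => ?_
    simp only
    rcases le_total x m with h | h
    · have := hp.mul_le_mul_shift h (sub_nonneg.2 huv)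
      nlinarith
    · have := hp.mul_le_mul_shift h (sub_nonneg.2 huv)
      nlinarith
  rw [e1, mul_zero, ← e2, setIntegral_quadratic_mul hp hi] at h3
  have h4 := nonpos_of_mul_nonpos_right h3 (hp.pos m)
  have h5 : moment p 1 (Ioi v) / moment p 0 (Ioi v) ≤ m + (v - u) := by
    rw [div_le_iff₀ hv0]; linarith
  have h6 : excess p v = moment p 1 (Ioi v) / moment p 0 (Ioi v) - v := rfl
  linarith

lemma continuous_excess (hp : IsSourceDensity p) (hi : Integrable p) :
    Continuous (excess p) := by
  refine continuous_iff_continuousAt.2 fun u => ?_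
  exact ((hasDerivAt_tail hp hi 1 u).continuousAt.div (hasDerivAt_tail hp hi 0 u).continuousAt
    (tail_pos hp hi u).ne').sub continuousAt_id

lemma hasDerivAt_spread_tail (hp : IsSourceDensity p) (hi : Integrable p) (u : ℝ) :
    HasDerivAt (fun u => spread p (Ioi u)) (-(p u * excess p u ^ 2)) u := by
  have h := (hasDerivAt_tail hp hi 2 u).sub (((hasDerivAt_tail hp hi 1 u).pow 2).div
    (hasDerivAt_tail hp hi 0 u) (tail_pos hp hi u).ne')
  refine h.congr_deriv ?_
  have := (tail_pos hp hi u).ne'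
  simp only [excess, Pi.pow_apply]
  field_simp
  ring

/-- As a function of the tail probability, the tail spread has derivative `excess²`, which is
nondecreasing; hence it is convex. This is the supporting-line inequality. -/
lemma spread_tail_ge (hp : IsSourceDensity p) (hi : Integrable p) (w u : ℝ) :
    spread p (Ioi w) + excess p w ^ 2 * (moment p 0 (Ioi u) - moment p 0 (Ioi w)) ≤
      spread p (Ioi u) := by
  set N : ℝ → ℝ := fun u => spread p (Ioi u) - excess p w ^ 2 * moment p 0 (Ioi u) with hN
  have hd : ∀ x, HasDerivAt N (p x * (excess p w ^ 2 - excess p x ^ 2)) x := by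
    intro x
    refine ((hasDerivAt_spread_tail hp hi x).sub
      ((hasDerivAt_tail hp hi 0 x).const_mul (excess p w ^ 2))).congr_deriv ?_
    ring
  have hc : Continuous N := continuous_iff_continuousAt.2 fun x => (hd x).continuousAt
  suffices N w ≤ N u by simp only [hN] at this; linarith
  rcases le_total w u with h | h
  · refine monotoneOn_of_deriv_nonneg (convex_Ici w) hc.continuousOn
      (fun x _ => (hd x).differentiableAt.differentiableWithinAt) (fun x hx => ?_)
      self_mem_Ici h h
    rw [(hd x).deriv]
    rw [interior_Ici] at hx
    have := antitone_excess hp hi (le_of_lt hx)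
    exact mul_nonneg (hp.pos x).le
      (sub_nonneg.2 (pow_le_pow_left₀ (excess_pos hp hi x).le this 2))
  · refine antitoneOn_of_deriv_nonpos (convex_Iic w) hc.continuousOn
      (fun x _ => (hd x).differentiableAt.differentiableWithinAt) (fun x hx => ?_)
      h self_mem_Iic h
    rw [(hd x).deriv]
    rw [interior_Iic] at hx
    have := antitone_excess hp hi (le_of_lt hx)
    exact mul_nonpos_of_nonneg_of_nonpos (hp.pos x).le
      (sub_nonpos.2 (pow_le_pow_left₀ (excess_pos hp hi w).le this 2))

/-! ### Reduction of an ordered three-cell partition to a symmetric threshold -/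

/-- The cost of the symmetric threshold `b ≥ 0` as a function of tail moments, where `a` is the
fraction of the variance that survives transmission; `moment p 2 univ - 2 * moment p 2 (Ioi b)` is
the second moment over `(-b, b]`. -/
noncomputable def thresholdCost (p : ℝ → ℝ) (c a b : ℝ) : ℝ :=
  c * (2 * moment p 0 (Ioi b)) + (moment p 2 univ - 2 * moment p 2 (Ioi b)) +
    2 * a * spread p (Ioi b)

/-- Let three cells have probabilities `mᵢ`, first moments `sᵢ` and ordered means `sᵢ / mᵢ`. Moving
first moment towards the upper cell `1` and away from the lower cell `2`, at fixed probabilities,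
increases the second moment of the cell means. -/
lemma sum_sq_div_le {m₀ m₁ m₂ s₀ s₁ s₂ t₀ t₁ t₂ : ℝ} (h₀ : 0 < m₀) (h₁ : 0 < m₁) (h₂ : 0 < m₂)
    (hlt : s₂ / m₂ < s₀ / m₀) (hlt' : s₀ / m₀ < s₁ / m₁) (ht₁ : s₁ ≤ t₁) (ht₂ : t₂ ≤ s₂)
    (hsum : s₀ + s₁ + s₂ = t₀ + t₁ + t₂) :
    s₀ ^ 2 / m₀ + s₁ ^ 2 / m₁ + s₂ ^ 2 / m₂ ≤ t₀ ^ 2 / m₀ + t₁ ^ 2 / m₁ + t₂ ^ 2 / m₂ := by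
  -- the tangent line of a convex function of the cell mean
  have key : ∀ {m s t : ℝ}, 0 < m → s ^ 2 / m + 2 * (s / m) * (t - s) ≤ t ^ 2 / m := by
    intro m s t hm
    have : t ^ 2 / m - (s ^ 2 / m + 2 * (s / m) * (t - s)) = (t - s) ^ 2 / m := by
      field_simp; ring
    have : 0 ≤ (t - s) ^ 2 / m := by positivity
    linarith
  have k₀ := key h₀ (s := s₀) (t := t₀)
  have k₁ := key h₁ (s := s₁) (t := t₁)
  have k₂ := key h₂ (s := s₂) (t := t₂)
  have e : t₀ - s₀ = -(t₁ - s₁) - (t₂ - s₂) := by linarith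
  rw [e] at k₀
  nlinarith [mul_nonneg (sub_nonneg.2 hlt'.le) (sub_nonneg.2 ht₁),
    mul_nonneg (sub_nonneg.2 hlt.le) (sub_nonneg.2 ht₂)]

lemma moment_zero_mono (hp : IsSourceDensity p) (hi : Integrable p) {A B : Set ℝ} (h : A ⊆ B) :
    moment p 0 A ≤ moment p 0 B :=
  setIntegral_mono_set (hp.integrable_pow_mul hi 0).integrableOn
    (ae_of_all _ fun x => by simpa using (hp.pos x).le) h.eventuallyLE

lemma moment_two_centred_le_spread (hp : IsSourceDensity p) (hi : Integrable p) {w : ℝ}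
    (hw : 0 ≤ w) {A : Set ℝ} (hA : MeasurableSet A) (hA0 : 0 < moment p 0 A)
    (h0 : moment p 0 A = moment p 0 (Ioc (-w) w)) :
    moment p 2 (Ioc (-w) w) ≤ spread p A := by
  refine (moment_two_centred_le hp hi hw hA h0 (moment p 1 A / moment p 0 A)).trans_eq ?_
  rw [spread]; field_simp; ring

/-- The tail contains the most first moment among all regions of the same probability. -/
lemma moment_one_le_tail (hp : IsSourceDensity p) (hi : Integrable p) {A : Set ℝ}
    (hA : MeasurableSet A) {u : ℝ} (h : moment p 0 (Ioi u) = moment p 0 A) :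
    moment p 1 A ≤ moment p 1 (Ioi u) := by
  have := setIntegral_le_of_sign (integrable_quadratic_mul hp hi 0 1 (-u)) hA
    (measurableSet_Ioi (a := u))
    (fun x hx => mul_nonneg (by linarith [mem_Ioi.1 hx]) (hp.pos x).le)
    (fun x hx => mul_nonpos_of_nonpos_of_nonneg (by linarith [notMem_Ioi.1 hx]) (hp.pos x).le)
  rw [setIntegral_quadratic_mul hp hi, setIntegral_quadratic_mul hp hi, h] at this
  linarith

lemma neg_tail_le_moment_one (hp : IsSourceDensity p) (hi : Integrable p) {A : Set ℝ}
    (hA : MeasurableSet A) {v : ℝ} (h : moment p 0 (Ioi v) = moment p 0 A) :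
    -moment p 1 (Ioi v) ≤ moment p 1 A := by
  have := setIntegral_le_of_sign (integrable_quadratic_mul hp hi 0 (-1) (-v)) hA
    (measurableSet_Iic (a := -v))
    (fun x hx => mul_nonneg (by linarith [mem_Iic.1 hx]) (hp.pos x).le)
    (fun x hx => mul_nonpos_of_nonpos_of_nonneg (by linarith [notMem_Iic.1 hx]) (hp.pos x).le)
  rw [setIntegral_quadratic_mul hp hi, setIntegral_quadratic_mul hp hi, moment_Iic_neg hp,
    moment_Iic_neg hp, moment_Iic_neg hp, ← h] at this
  linarith

/-- A partition of the line into a middle cell `A₀` and two one-sided cells `A₁`, `A₂` with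
ordered means costs at least as much as the symmetric threshold with the same probability of the
middle cell. Both costs are affine in `a`, so it suffices to compare them at `a = 0` and `a = 1`. -/
lemma exists_thresholdCost_le (hp : IsSourceDensity p) (hi : Integrable p) {A₀ A₁ A₂ : Set ℝ}
    (hA₀ : MeasurableSet A₀) (hA₁ : MeasurableSet A₁) (hA₂ : MeasurableSet A₂)
    (h₁ : A₁ ⊆ Ioi 0) (h₂ : A₂ ⊆ Iio 0)
    (hsum : ∀ k, moment p k A₀ + moment p k A₁ + moment p k A₂ = moment p k univ)
    (m₀ : 0 < moment p 0 A₀) (m₁ : 0 < moment p 0 A₁) (m₂ : 0 < moment p 0 A₂)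
    (hlt : moment p 1 A₂ / moment p 0 A₂ < moment p 1 A₀ / moment p 0 A₀)
    (hlt' : moment p 1 A₀ / moment p 0 A₀ < moment p 1 A₁ / moment p 0 A₁)
    (c : ℝ) {a : ℝ} (ha : 0 ≤ a) (ha' : a ≤ 1) :
    ∃ w, 0 < w ∧ thresholdCost p c a w ≤ c * (moment p 0 A₁ + moment p 0 A₂) + spread p A₀ +
      a * (spread p A₁ + spread p A₂) := by
  have t₁ : moment p 0 A₁ ≤ moment p 0 (Ioi 0) := moment_zero_mono hp hi h₁
  have t₂ : moment p 0 A₂ ≤ moment p 0 (Ioi 0) := by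
    refine (moment_zero_mono hp hi (h₂.trans Iio_subset_Iic_self)).trans_eq ?_
    simpa using moment_Iic_neg hp 0 0
  have hu0 := moment_univ_eq hp hi 0 (u := 0) (v := 0) (by simp)
  simp only [neg_zero, Ioc_self, pow_zero, one_mul] at hu0
  rw [show moment p 0 ∅ = 0 by simp [moment]] at hu0
  obtain ⟨w, hw, hw'⟩ := exists_tail_eq hp hi (m := (moment p 0 A₁ + moment p 0 A₂) / 2)
    (by linarith) (by linarith)
  obtain ⟨u, hu, hu'⟩ := exists_tail_eq hp hi m₁ t₁
  obtain ⟨v, hv, hv'⟩ := exists_tail_eq hp hi m₂ t₂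
  have hs0 := hsum 0
  have hwpos : 0 < w := by
    refine hw.lt_of_ne fun h => ?_
    subst h
    linarith
  have hcent := moment_univ_eq hp hi 0 (u := w) (v := w) (by linarith)
  have hcent2 := moment_univ_eq hp hi 2 (u := w) (v := w) (by linarith)
  have hmid := moment_univ_eq hp hi 0 (u := u) (v := v) (by linarith)
  have hmid1 := moment_univ_eq hp hi 1 (u := u) (v := v) (by linarith)
  have hmid2 := moment_univ_eq hp hi 2 (u := u) (v := v) (by linarith)
  norm_num at hcent hcent2 hmid hmid1 hmid2
  have hB₀ : moment p 0 (Ioc (-v) u) = moment p 0 A₀ := by linarith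
  -- the comparison at `a = 0`
  have c0 : moment p 2 (Ioc (-w) w) ≤ spread p A₀ :=
    moment_two_centred_le_spread hp hi hw hA₀ m₀ (by linarith)
  -- the comparison at `a = 1`, through the interval partition with the same cell probabilities
  have c1 : moment p 2 (Ioc (-w) w) + 2 * spread p (Ioi w) ≤
      spread p A₀ + (spread p A₁ + spread p A₂) := by
    have d1 : moment p 2 (Ioc (-w) w) ≤ spread p (Ioc (-v) u) :=
      moment_two_centred_le_spread hp hi hw measurableSet_Ioc (by linarith) (by linarith)
    have d2 : 2 * spread p (Ioi w) ≤ spread p (Ioi u) + spread p (Ioi v) := by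
      have e1 := spread_tail_ge hp hi w u
      have e2 := spread_tail_ge hp hi w v
      have e3 : (moment p 0 (Ioi u) - moment p 0 (Ioi w)) =
        -(moment p 0 (Ioi v) - moment p 0 (Ioi w)) := by linarith
      rw [e3] at e1
      linarith
    have d3 := sum_sq_div_le m₀ m₁ m₂ hlt hlt' (moment_one_le_tail hp hi hA₁ hu')
      (neg_tail_le_moment_one hp hi hA₂ hv') (t₀ := moment p 1 (Ioc (-v) u))
      (by linarith [hsum 1])
    have hs2 := hsum 2
    have d4 : spread p A₀ + (spread p A₁ + spread p A₂) = moment p 2 univ -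
        (moment p 1 A₀ ^ 2 / moment p 0 A₀ + moment p 1 A₁ ^ 2 / moment p 0 A₁ +
          moment p 1 A₂ ^ 2 / moment p 0 A₂) := by
      simp only [spread]; linarith
    have d5 : spread p (Ioc (-v) u) + (spread p (Ioi u) + spread p (Ioi v)) = moment p 2 univ -
        (moment p 1 (Ioc (-v) u) ^ 2 / moment p 0 A₀ + moment p 1 (Ioi u) ^ 2 / moment p 0 A₁ +
          (-moment p 1 (Ioi v)) ^ 2 / moment p 0 A₂) := by
      simp only [spread, hB₀, hu', hv', neg_sq]; linarith
    linarith
  refine ⟨w, hwpos, ?_⟩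
  have e : thresholdCost p c a w = c * (moment p 0 A₁ + moment p 0 A₂) +
      moment p 2 (Ioc (-w) w) + a * (2 * spread p (Ioi w)) := by
    rw [thresholdCost, hw']
    linear_combination hcent2
  rw [e]
  nlinarith [mul_le_mul_of_nonneg_left c0 (sub_nonneg.2 ha'), mul_le_mul_of_nonneg_left c1 ha]

/-! ### The optimal symmetric threshold -/

lemma hasDerivAt_thresholdCost (hp : IsSourceDensity p) (hi : Integrable p) (c a b : ℝ) :
    HasDerivAt (thresholdCost p c a) (2 * p b * (b ^ 2 - c - a * excess p b ^ 2)) b := by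
  refine (((((hasDerivAt_tail hp hi 0 b).const_mul 2).const_mul c).add
    (((hasDerivAt_tail hp hi 2 b).const_mul 2).const_sub (moment p 2 univ))).add
    ((hasDerivAt_spread_tail hp hi b).const_mul (2 * a))).congr_deriv ?_
  ring

lemma strictMonoOn_stationarity (hp : IsSourceDensity p) (hi : Integrable p) (c : ℝ) {a : ℝ}
    (ha : 0 ≤ a) : StrictMonoOn (fun b => b ^ 2 - c - a * excess p b ^ 2) (Ici 0) := by
  intro x hx y hy hxy
  have h1 := antitone_excess hp hi hxy.le
  have h2 := pow_le_pow_left₀ (excess_pos hp hi y).le h1 2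
  have h3 := mul_le_mul_of_nonneg_left h2 ha
  have h4 : x ^ 2 < y ^ 2 := pow_lt_pow_left₀ hxy hx two_ne_zero
  simp only
  linarith

/-- The cost of symmetric thresholds is strictly unimodal, with minimizer the unique solution of
the stationarity equation. -/
lemma exists_optimal_threshold (hp : IsSourceDensity p) (hi : Integrable p) {c a : ℝ}
    (hc : 0 < c) (ha : 0 ≤ a) : ∃ β, 0 < β ∧
      (∀ b, 0 ≤ b → b ≠ β → thresholdCost p c a β < thresholdCost p c a b) ∧
      ∀ b, 0 ≤ b → (b ^ 2 - c - a * excess p b ^ 2 = 0 ↔ b = β) := by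
  set φ : ℝ → ℝ := fun b => b ^ 2 - c - a * excess p b ^ 2 with hφ
  have hmono := strictMonoOn_stationarity hp hi c ha
  have hcont : Continuous φ := by
    have := continuous_excess hp hi
    fun_prop
  have hφ0 : φ 0 < 0 := by
    have := mul_nonneg ha (sq_nonneg (excess p 0))
    simp only [hφ]; linarith
  set N := c + a * excess p 0 ^ 2 + 1 with hN
  have hK : 0 ≤ a * excess p 0 ^ 2 := by positivity
  have hN0 : 0 ≤ N := by linarith
  have hφN : 0 ≤ φ N := by
    have h2 := mul_le_mul_of_nonneg_left
      (pow_le_pow_left₀ (excess_pos hp hi N).le (antitone_excess hp hi hN0) 2) ha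
    have : N ≤ N ^ 2 := by nlinarith
    simp only [hφ]; linarith
  obtain ⟨β, hβ, hβ0⟩ := intermediate_value_Icc hN0 hcont.continuousOn ⟨hφ0.le, hφN⟩
  have hβpos : 0 < β := by
    refine hβ.1.lt_of_ne fun h => ?_
    rw [← h] at hβ0; linarith
  have hd := hasDerivAt_thresholdCost hp hi c a
  have hJ : Continuous (thresholdCost p c a) :=
    continuous_iff_continuousAt.2 fun x => (hd x).continuousAt
  refine ⟨β, hβpos, fun b hb hne => ?_, fun b hb => ⟨fun h => ?_, fun h => h ▸ hβ0⟩⟩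
  · rcases hne.lt_or_gt with h | h
    · refine strictAntiOn_of_deriv_neg (convex_Icc 0 β) hJ.continuousOn (fun x hx => ?_)
        ⟨hb, h.le⟩ ⟨hβpos.le, le_rfl⟩ h
      rw [interior_Icc] at hx
      rw [(hd x).deriv]
      have := hmono (mem_Ici.2 hx.1.le) (mem_Ici.2 hβpos.le) hx.2
      exact mul_neg_of_pos_of_neg (mul_pos two_pos (hp.pos x)) (this.trans_eq hβ0)
    · refine strictMonoOn_of_deriv_pos (convex_Ici β) hJ.continuousOn (fun x hx => ?_)
        self_mem_Ici (mem_Ici.2 h.le) h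
      rw [interior_Ici] at hx
      rw [(hd x).deriv]
      have := hmono (mem_Ici.2 hβpos.le) (mem_Ici.2 (hβpos.trans hx).le) hx
      exact mul_pos (mul_pos two_pos (hp.pos x)) (hβ0.symm.trans_lt this)
  · exact hmono.injOn hb hβpos.le (h.trans hβ0.symm)

/-! ### Transfer to the probability space -/

section Transfer

variable {Ω : Type*} [MeasurableSpace Ω] {μ : Measure Ω} {X V : Ω → ℝ}

lemma integral_cond_eq (s : Set Ω) (F : Ω → ℝ) :
    ∫ ω, F ω ∂(μ[|s]) = (∫ ω in s, F ω ∂μ) / μ.real s := by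
  rw [ProbabilityTheory.cond, integral_smul_measure, ENNReal.toReal_inv, smul_eq_mul,
    div_eq_inv_mul]
  rfl

lemma HasDensity.integrable_density [IsProbabilityMeasure μ] (hX : HasDensity μ X p)
    (hp : IsSourceDensity p) : Integrable p := by
  refine ⟨hp.continuous.aestronglyMeasurable, ?_⟩
  rw [hasFiniteIntegral_iff_ofReal (ae_of_all _ fun x => (hp.pos x).le)]
  have h : (μ.map X) univ = ∫⁻ x, ENNReal.ofReal (p x) := by
    rw [hX.map_eq, withDensity_apply _ MeasurableSet.univ, Measure.restrict_univ]
  rw [← h, Measure.map_apply hX.measurable MeasurableSet.univ]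
  exact measure_lt_top _ _

lemma HasDensity.integrable_comp (hX : HasDensity μ X p) (hp : IsSourceDensity p)
    {g : ℝ → ℝ} (hg : Measurable g) (h : Integrable (fun x => g x * p x)) :
    Integrable (fun ω => g (X ω)) μ := by
  have h1 : Integrable g (μ.map X) := by
    rw [hX.map_eq, integrable_withDensity_iff (hp.continuous.measurable.ennreal_ofReal)
      (ae_of_all _ fun _ => ENNReal.ofReal_lt_top)]
    simpa only [ENNReal.toReal_ofReal (hp.pos _).le] using h
  exact (integrable_map_measure hg.aestronglyMeasurable hX.measurable.aemeasurable).1 h1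

lemma HasDensity.setIntegral_comp (hX : HasDensity μ X p) (hp : IsSourceDensity p)
    {g : ℝ → ℝ} (hg : Measurable g) {A : Set ℝ} (hA : MeasurableSet A) :
    ∫ ω in X ⁻¹' A, g (X ω) ∂μ = ∫ x in A, g x * p x := by
  rw [← setIntegral_map hA hg.aestronglyMeasurable hX.measurable.aemeasurable, hX.map_eq,
    setIntegral_withDensity_eq_setIntegral_toReal_smul hp.continuous.measurable.ennreal_ofReal
      (ae_of_all _ fun _ => ENNReal.ofReal_lt_top) _ hA]
  congr 1; funext x
  rw [ENNReal.toReal_ofReal (hp.pos x).le, smul_eq_mul, mul_comm]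

lemma HasDensity.setIntegral_quadratic [IsProbabilityMeasure μ] (hX : HasDensity μ X p)
    (hp : IsSourceDensity p) (r s t : ℝ) {A : Set ℝ} (hA : MeasurableSet A) :
    ∫ ω in X ⁻¹' A, (r * X ω ^ 2 + s * X ω + t) ∂μ =
      r * moment p 2 A + s * moment p 1 A + t * moment p 0 A := by
  rw [← setIntegral_quadratic_mul hp (hX.integrable_density hp)]
  exact hX.setIntegral_comp hp (g := fun x => r * x ^ 2 + s * x + t) (by fun_prop) hA

lemma HasDensity.integrable_quadratic [IsProbabilityMeasure μ] (hX : HasDensity μ X p)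
    (hp : IsSourceDensity p) (r s t : ℝ) :
    Integrable (fun ω => r * X ω ^ 2 + s * X ω + t) μ :=
  hX.integrable_comp hp (g := fun x => r * x ^ 2 + s * x + t) (by fun_prop)
    (integrable_quadratic_mul hp (hX.integrable_density hp) r s t)

lemma HasDensity.memLp_two [IsProbabilityMeasure μ] (hX : HasDensity μ X p)
    (hp : IsSourceDensity p) : MemLp X 2 μ :=
  (memLp_two_iff_integrable_sq hX.measurable.aestronglyMeasurable).2
    (by simpa using hX.integrable_quadratic hp 1 0 0)

lemma HasDensity.measureReal_preimage [IsProbabilityMeasure μ] (hX : HasDensity μ X p)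
    (hp : IsSourceDensity p) {A : Set ℝ} (hA : MeasurableSet A) :
    μ.real (X ⁻¹' A) = moment p 0 A := by
  simpa using hX.setIntegral_quadratic hp 0 0 1 hA

lemma HasDensity.moment_zero_pos_iff [IsProbabilityMeasure μ] (hX : HasDensity μ X p)
    (hp : IsSourceDensity p) {A : Set ℝ} (hA : MeasurableSet A) :
    0 < μ (X ⁻¹' A) ↔ 0 < moment p 0 A := by
  rw [← hX.measureReal_preimage hp hA, measureReal_def, ENNReal.toReal_pos_iff]
  simp [measure_lt_top]

lemma HasDensity.regionMean_eq [IsProbabilityMeasure μ] (hX : HasDensity μ X p)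
    (hp : IsSourceDensity p) {A : Set ℝ} (hA : MeasurableSet A) :
    regionMean μ X A = moment p 1 A / moment p 0 A := by
  rw [regionMean, integral_cond_eq, hX.measureReal_preimage hp hA]
  congr 1
  simpa using hX.setIntegral_quadratic hp 0 1 0 hA

/-- The second central moment is the integral of the squared deviation from the mean. -/
lemma HasDensity.setIntegral_sq_sub [IsProbabilityMeasure μ] (hX : HasDensity μ X p)
    (hp : IsSourceDensity p) {A : Set ℝ} (hA : MeasurableSet A) (h0 : 0 < moment p 0 A) :
    ∫ ω in X ⁻¹' A, (X ω - regionMean μ X A) ^ 2 ∂μ = spread p A := by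
  have e := hX.setIntegral_quadratic hp 1 (-2 * regionMean μ X A) (regionMean μ X A ^ 2) hA
  rw [hX.regionMean_eq hp hA] at e ⊢
  calc _ = _ := by congr 1; funext ω; ring
    _ = _ := e
    _ = _ := by rw [spread]; field_simp; ring

lemma HasDensity.regionVar_eq [IsProbabilityMeasure μ] (hX : HasDensity μ X p)
    (hp : IsSourceDensity p) {A : Set ℝ} (hA : MeasurableSet A) (h0 : 0 < moment p 0 A) :
    regionVar μ X A = spread p A / moment p 0 A := by
  rw [regionVar, variance_eq_integral hX.measurable.aemeasurable, integral_cond_eq,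
    hX.measureReal_preimage hp hA]
  congr 1
  exact hX.setIntegral_sq_sub hp hA h0

/-- Conditional independence of `V` and `X` given the sign of `X`, on a region where the sign is
constant. -/
lemma IsChannelNoise.setIntegral_mul_eq [IsProbabilityMeasure μ] (hV : IsChannelNoise μ X V)
    (hXm : Measurable X) {s : SignType} {A : Set ℝ} (hA : MeasurableSet A)
    (hAs : ∀ x ∈ A, SignType.sign x = s) (hpos : 0 < μ (X ⁻¹' A)) {g h : ℝ → ℝ}
    (hg : Measurable g) (hh : Measurable h) :
    ∫ ω in X ⁻¹' A, g (X ω) * h (V ω) ∂μ = (∫ ω in X ⁻¹' A, g (X ω) ∂μ) *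
      ∫ ω, h (V ω) ∂(μ[|{ω | SignType.sign (X ω) = s}]) := by
  set E : Set Ω := {ω | SignType.sign (X ω) = s} with hE
  have hAE : X ⁻¹' A ⊆ E := fun ω hω => hAs _ hω
  have hEpos : μ.real E ≠ 0 :=
    (ENNReal.toReal_pos (hpos.trans_le (measure_mono hAE)).ne' (measure_ne_top _ _)).ne'
  have hind := (hV.condIndep s).symm.integral_fun_comp_mul_comp hXm.aemeasurable
    hV.measurable.aemeasurable (f := A.indicator g) (g := h)
    (hg.indicator hA).aestronglyMeasurable hh.aestronglyMeasurable
  have key : ∀ F : Ω → ℝ, ∫ ω in E, (X ⁻¹' A).indicator F ω ∂μ = ∫ ω in X ⁻¹' A, F ω ∂μ := by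
    intro F
    rw [setIntegral_indicator (hXm hA), inter_eq_self_of_subset_right hAE]
  have e1 : ∀ ω, A.indicator g (X ω) * h (V ω) =
      (X ⁻¹' A).indicator (fun ω => g (X ω) * h (V ω)) ω := by
    intro ω
    by_cases hω : X ω ∈ A <;> simp [hω]
  have e2 : ∀ ω, A.indicator g (X ω) = (X ⁻¹' A).indicator (fun ω => g (X ω)) ω := by
    intro ω
    by_cases hω : X ω ∈ A <;> simp [hω]
  rw [← hE, integral_cond_eq E (fun ω => A.indicator g (X ω) * h (V ω)),
    integral_cond_eq E (fun ω => A.indicator g (X ω))] at hind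
  simp only [e1] at hind
  simp only [e2, key] at hind
  field_simp at hind
  linarith

/-! ### The cost of an admissible policy -/

lemma measurableSet_region₀ {f : ℝ → Fin 2} (hf : Measurable f) : MeasurableSet (region₀ f) :=
  hf (measurableSet_singleton 0)

lemma measurableSet_region₁ {f : ℝ → Fin 2} (hf : Measurable f) (s : SignType) :
    MeasurableSet (region₁ f s) := by
  refine (hf (measurableSet_singleton 1)).inter (?_ : MeasurableSet {x : ℝ | SignType.sign x = s})
  cases s
  · simp
  · rw [show {x : ℝ | SignType.sign x = SignType.neg} = Iio 0 from
      Set.ext fun x => sign_eq_neg_one_iff]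
    exact measurableSet_Iio
  · rw [show {x : ℝ | SignType.sign x = SignType.pos} = Ioi 0 from
      Set.ext fun x => sign_eq_one_iff]
    exact measurableSet_Ioi

/-- On a transmission region the estimation error is `a (X - m)` minus a multiple of the noise;
the cross term vanishes, and the gain is such that the two squares add up to `a` times the
variance, where `a = 1 / (γ + 1)`. -/
lemma integral_stageCost_region₁ [IsProbabilityMeasure μ] {P c : ℝ} (hp : IsSourceDensity p)
    (hX : HasDensity μ X p) (hV : IsChannelNoise μ X V) (hP : 0 < P) {f : ℝ → Fin 2}
    (hf : Measurable f) {s : SignType} (hs : s ≠ 0) (hpos : 0 < μ (X ⁻¹' region₁ f s)) :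
    IntegrableOn (stageCost μ X V P c f) (X ⁻¹' region₁ f s) μ ∧
    ∫ ω in X ⁻¹' region₁ f s, stageCost μ X V P c f ω ∂μ =
      c * moment p 0 (region₁ f s) + 1 / (snr μ V P + 1) * spread p (region₁ f s) := by
  have hi := hX.integrable_density hp
  set A := region₁ f s with hAdef
  have hA : MeasurableSet A := measurableSet_region₁ hf s
  have h0 : 0 < moment p 0 A := (hX.moment_zero_pos_iff hp hA).1 hpos
  have hAs : ∀ x ∈ A, SignType.sign x = s := fun x hx => hx.2
  set m := regionMean μ X A with hm
  set σ := variance V μ with hσ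
  have hσ0 : 0 < σ := hV.variance_pos
  set γ := snr μ V P with hγ
  have hγ' : γ = P / σ := rfl
  have hγ0 : 0 < γ := div_pos hP hσ0
  have hL : 0 < spread p A := spread_pos hp hi h0
  have hvar := hX.regionVar_eq hp hA h0
  have hvarpos : 0 < regionVar μ X A := by rw [hvar]; positivity
  set α := gain μ X P f s with hα
  have hα0 : 0 < α := Real.sqrt_pos.2 (div_pos hP hvarpos)
  have hαsq : α ^ 2 = P / regionVar μ X A := Real.sq_sqrt (div_pos hP hvarpos).le
  have hss : (s : ℝ) ^ 2 = 1 := by cases s <;> simp_all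
  set a := 1 / (γ + 1) with ha
  set k := (s : ℝ) * (1 / α) * (γ / (γ + 1)) with hk
  have hpt : ∀ ω ∈ X ⁻¹' A, stageCost μ X V P c f ω =
      (a ^ 2 * X ω ^ 2 + (-2 * a ^ 2 * m) * X ω + (a ^ 2 * m ^ 2 + c)) +
        k ^ 2 * V ω ^ 2 - 2 * a * k * ((X ω - m) * V ω) := by
    intro ω hω
    have h1 : f (X ω) = 1 := hω.1
    have h2 : SignType.sign (X ω) = s := hω.2
    have e : X ω - estimate μ X V P f ω = a * (X ω - m) - k * V ω := by
      simp only [estimate, sensorMessage, h1, if_true, sideMessage, Option.map_some, encoder,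
        decoder, h2]
      rw [← hAdef, ← hm, ← hα, ← hγ, hk, ha]
      field_simp
      linear_combination -(X ω - m) * γ * α * hss
    rw [stageCost, e, h1]
    simp only [Fin.val_one, Nat.cast_one]
    ring
  have i1 := (hX.integrable_quadratic hp (a ^ 2) (-2 * a ^ 2 * m)
    (a ^ 2 * m ^ 2 + c)).integrableOn (s := X ⁻¹' A)
  have i2 := (hV.memLp.integrable_sq.const_mul (k ^ 2)).integrableOn (s := X ⁻¹' A)
  have hXV : Integrable (fun ω => (X ω - m) * V ω) μ :=
    ((hX.memLp_two hp).sub (memLp_const m)).integrable_mul hV.memLp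
  have i3 := (hXV.const_mul (2 * a * k)).integrableOn (s := X ⁻¹' A)
  have i12 : IntegrableOn (fun ω => (a ^ 2 * X ω ^ 2 + (-2 * a ^ 2 * m) * X ω +
    (a ^ 2 * m ^ 2 + c)) + k ^ 2 * V ω ^ 2) (X ⁻¹' A) μ := i1.add i2
  have hmA := hX.measurable hA
  refine ⟨(i12.sub i3).congr_fun (fun ω hω => (hpt ω hω).symm) hmA, ?_⟩
  rw [setIntegral_congr_fun hmA hpt, integral_sub i12 i3, integral_add i1 i2,
    integral_const_mul, integral_const_mul, hX.setIntegral_quadratic hp _ _ _ hA]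
  have hcross : ∫ ω in X ⁻¹' A, (X ω - m) * V ω ∂μ = 0 := by
    rw [hV.setIntegral_mul_eq hX.measurable hA hAs hpos (g := fun x => x - m) (h := fun v => v)
      (by fun_prop) (by fun_prop)]
    have e := hX.setIntegral_quadratic hp 0 1 (-m) hA
    have e2 : ∫ ω in X ⁻¹' A, (X ω - m) ∂μ = 0 := by
      calc _ = _ := by congr 1; funext ω; ring
        _ = _ := e
        _ = 0 := by rw [hm, hX.regionMean_eq hp hA]; field_simp; ring
    rw [e2, zero_mul]
  have hpow : ∫ ω in X ⁻¹' A, V ω ^ 2 ∂μ = moment p 0 A * σ := by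
    have e := hV.setIntegral_mul_eq hX.measurable hA hAs hpos (g := fun _ => 1)
      (h := fun v => v ^ 2) (by fun_prop) (by fun_prop)
    rw [hV.cond_power s hs] at e
    simpa [hX.measureReal_preimage hp hA] using e
  rw [hcross, hpow]
  have hk2 : k ^ 2 * (moment p 0 A * σ) = γ * a ^ 2 * spread p A := by
    have e1 : k ^ 2 = (α ^ 2)⁻¹ * (γ / (γ + 1)) ^ 2 := by
      rw [hk, mul_pow, mul_pow, hss]; field_simp
    rw [e1, hαsq, hvar, ha, hγ']
    field_simp
  have hsp : moment p 2 A - 2 * m * moment p 1 A + m ^ 2 * moment p 0 A = spread p A := by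
    rw [hm, hX.regionMean_eq hp hA, spread]; field_simp; ring
  have ha2 : a ^ 2 + γ * a ^ 2 = a := by rw [ha]; field_simp; ring
  rw [hk2]
  linear_combination a ^ 2 * hsp + spread p A * ha2

lemma integral_stageCost_region₀ [IsProbabilityMeasure μ] {P c : ℝ} (hp : IsSourceDensity p)
    (hX : HasDensity μ X p) {f : ℝ → Fin 2} (hf : Measurable f)
    (hpos : 0 < μ (X ⁻¹' region₀ f)) :
    IntegrableOn (stageCost μ X V P c f) (X ⁻¹' region₀ f) μ ∧
    ∫ ω in X ⁻¹' region₀ f, stageCost μ X V P c f ω ∂μ = spread p (region₀ f) := by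
  have hA := measurableSet_region₀ hf
  have hpt : ∀ ω ∈ X ⁻¹' region₀ f, stageCost μ X V P c f ω =
      (X ω - regionMean μ X (region₀ f)) ^ 2 := by
    intro ω hω
    have h1 : f (X ω) = 0 := hω
    simp [stageCost, estimate, sensorMessage, h1, sideMessage, decoder]
  have hmA := hX.measurable hA
  have hint : Integrable (fun ω => (X ω - regionMean μ X (region₀ f)) ^ 2) μ :=
    ((hX.memLp_two hp).sub (memLp_const _)).integrable_sq
  refine ⟨hint.integrableOn.congr_fun (fun ω hω => (hpt ω hω).symm) hmA, ?_⟩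
  rw [setIntegral_congr_fun hmA hpt,
    hX.setIntegral_sq_sub hp hA ((hX.moment_zero_pos_iff hp hA).1 hpos)]

/-- The regions of a policy partition the line, up to the point `0`. -/
lemma ae_univ_eq_regions (f : ℝ → Fin 2) :
    (univ : Set ℝ) =ᵐ[volume] (region₀ f ∪ (region₁ f 1 ∪ region₁ f (-1)) : Set ℝ) := by
  have h : ∀ᵐ x : ℝ, x ≠ 0 := by simp [ae_iff]
  filter_upwards [h] with x hx
  refine propext ⟨fun _ => ?_, fun _ => trivial⟩
  by_cases h0 : f x = 0
  · exact Or.inl h0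
  · have h1 : f x = 1 := by omega
    rcases hx.lt_or_gt with h | h
    · exact Or.inr (Or.inr ⟨h1, sign_neg h⟩)
    · exact Or.inr (Or.inl ⟨h1, sign_pos h⟩)

lemma disjoint_region₀ (f : ℝ → Fin 2) :
    Disjoint (region₀ f) (region₁ f 1 ∪ region₁ f (-1)) := by
  rw [Set.disjoint_left]
  rintro x (h0 : f x = 0) (h | h) <;> exact absurd (h0.symm.trans h.1) (by decide)

lemma disjoint_region₁ (f : ℝ → Fin 2) : Disjoint (region₁ f 1) (region₁ f (-1)) := by
  rw [Set.disjoint_left]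
  rintro x h h'
  exact absurd (h.2.symm.trans h'.2) (by decide)

lemma moment_regions (hp : IsSourceDensity p) (hi : Integrable p) {f : ℝ → Fin 2}
    (hf : Measurable f) (k : ℕ) : moment p k (region₀ f) + moment p k (region₁ f 1) +
      moment p k (region₁ f (-1)) = moment p k univ := by
  rw [show moment p k univ = moment p k (region₀ f ∪ (region₁ f 1 ∪ region₁ f (-1))) from
    setIntegral_congr_set (ae_univ_eq_regions f),
    moment_union hp hi k ((measurableSet_region₁ hf _).union (measurableSet_region₁ hf _))
      (disjoint_region₀ f),
    moment_union hp hi k (measurableSet_region₁ hf _) (disjoint_region₁ f), add_assoc]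

lemma Admissible.cost [IsProbabilityMeasure μ] {P : ℝ} (c : ℝ) (hp : IsSourceDensity p)
    (hX : HasDensity μ X p) (hV : IsChannelNoise μ X V) (hP : 0 < P) {f : ℝ → Fin 2}
    (hf : Admissible μ X f) :
    Integrable (stageCost μ X V P c f) μ ∧
    expectedCost μ X V P c f = c * (moment p 0 (region₁ f 1) + moment p 0 (region₁ f (-1))) +
      spread p (region₀ f) + 1 / (snr μ V P + 1) *
        (spread p (region₁ f 1) + spread p (region₁ f (-1))) := by
  have hfm := hf.measurable
  obtain ⟨i₀, e₀⟩ := integral_stageCost_region₀ (V := V) (P := P) (c := c) hp hX hfm hf.region₀_pos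
  obtain ⟨i₁, e₁⟩ := integral_stageCost_region₁ (c := c) hp hX hV hP hfm (s := 1) (by decide)
    hf.region_pos_pos
  obtain ⟨i₂, e₂⟩ := integral_stageCost_region₁ (c := c) hp hX hV hP hfm (s := -1) (by decide)
    hf.region_neg_pos
  have hac : μ.map X ≪ volume := by
    rw [hX.map_eq]; exact withDensity_absolutelyContinuous _ _
  have hae : (univ : Set Ω) =ᵐ[μ]
      (X ⁻¹' region₀ f ∪ (X ⁻¹' region₁ f 1 ∪ X ⁻¹' region₁ f (-1)) : Set Ω) :=
    ae_of_ae_map hX.measurable.aemeasurable (hac.ae_le (ae_univ_eq_regions f))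
  have m₁ := hX.measurable (measurableSet_region₁ hfm 1)
  have m₂ := hX.measurable (measurableSet_region₁ hfm (-1))
  constructor
  · rw [← integrableOn_univ]
    exact (i₀.union (i₁.union i₂)).congr_set_ae hae
  · rw [expectedCost, ← setIntegral_univ, setIntegral_congr_set hae,
      setIntegral_union (by simpa using (disjoint_region₀ f).preimage X) (m₁.union m₂) i₀
        (i₁.union i₂),
      setIntegral_union ((disjoint_region₁ f).preimage X) m₂ i₁ i₂, e₀, e₁, e₂]
    ring

/-! ### Threshold policies -/

lemma measurable_thresholdPolicy (b : ℝ) : Measurable (thresholdPolicy b) :=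
  Measurable.ite (measurableSet_lt measurable_norm measurable_const) measurable_const
    measurable_const

lemma region₀_thresholdPolicy (b : ℝ) : region₀ (thresholdPolicy b) = Ioo (-b) b := by
  ext x
  simp [region₀, thresholdPolicy, abs_lt]

lemma region₁_one_thresholdPolicy {b : ℝ} (hb : 0 < b) :
    region₁ (thresholdPolicy b) 1 = Ici b := by
  ext x
  simp only [region₁, thresholdPolicy, mem_ofPred_eq, mem_Ici, sign_eq_one_iff]
  constructor
  · rintro ⟨h, hx⟩
    by_contra! hlt
    rw [if_pos (by rw [abs_of_pos hx]; exact hlt)] at h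
    exact absurd h (by decide)
  · intro h
    have hx := hb.trans_le h
    exact ⟨if_neg (by rw [abs_of_pos hx]; exact not_lt.2 h), hx⟩

lemma region₁_neg_one_thresholdPolicy {b : ℝ} (hb : 0 < b) :
    region₁ (thresholdPolicy b) (-1) = Iic (-b) := by
  ext x
  simp only [region₁, thresholdPolicy, mem_ofPred_eq, mem_Iic, sign_eq_neg_one_iff]
  constructor
  · rintro ⟨h, hx⟩
    by_contra! hlt
    rw [if_pos (by rw [abs_of_neg hx]; linarith)] at h
    exact absurd h (by decide)
  · intro h
    have hx : x < 0 := by linarith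
    exact ⟨if_neg (by rw [abs_of_neg hx]; linarith), hx⟩

lemma moment_Ioo_neg (hp : IsSourceDensity p) (hi : Integrable p) (k : ℕ) {b : ℝ} (hb : 0 < b) :
    moment p k (Ioo (-b) b) =
      moment p k univ - (-1) ^ k * moment p k (Ioi b) - moment p k (Ioi b) := by
  rw [moment_univ_eq hp hi k (u := b) (v := b) (by linarith),
    show moment p k (Ioo (-b) b) = moment p k (Ioc (-b) b) from
      setIntegral_congr_set Ioo_ae_eq_Ioc]
  ring

lemma moment_one_Ioo_neg (hp : IsSourceDensity p) (hi : Integrable p) {b : ℝ} (hb : 0 < b) :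
    moment p 1 (Ioo (-b) b) = 0 := by
  rw [moment_Ioo_neg hp hi 1 hb, moment_one_univ hp hi]; ring

lemma admissible_thresholdPolicy [IsProbabilityMeasure μ] (hp : IsSourceDensity p)
    (hX : HasDensity μ X p) {b : ℝ} (hb : 0 < b) : Admissible μ X (thresholdPolicy b) := by
  have hi := hX.integrable_density hp
  have hτ := tail_pos hp hi b
  have hpos : 0 < moment p 1 (Ioi b) / moment p 0 (Ioi b) := by
    have h : 0 < moment p 1 (Ioi b) / moment p 0 (Ioi b) - b := excess_pos hp hi b
    linarith
  refine ⟨measurable_thresholdPolicy b, ?_, ?_, ?_, ?_, ?_⟩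
  · rw [region₀_thresholdPolicy, hX.moment_zero_pos_iff hp measurableSet_Ioo]
    exact moment_zero_pos hp hi (by simp [Real.volume_Ioo]; linarith)
  · rwa [region₁_one_thresholdPolicy hb, hX.moment_zero_pos_iff hp measurableSet_Ici,
      moment_Ici]
  · rw [region₁_neg_one_thresholdPolicy hb, hX.moment_zero_pos_iff hp measurableSet_Iic,
      moment_Iic_neg hp]
    simpa using hτ
  · rw [region₀_thresholdPolicy, region₁_neg_one_thresholdPolicy hb,
      hX.regionMean_eq hp measurableSet_Ioo, hX.regionMean_eq hp measurableSet_Iic,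
      moment_one_Ioo_neg hp hi hb, moment_Iic_neg hp, moment_Iic_neg hp, zero_div, pow_one,
      pow_zero, one_mul, neg_one_mul, neg_div]
    exact neg_lt_zero.2 hpos
  · rw [region₀_thresholdPolicy, region₁_one_thresholdPolicy hb,
      hX.regionMean_eq hp measurableSet_Ioo, hX.regionMean_eq hp measurableSet_Ici,
      moment_one_Ioo_neg hp hi hb, moment_Ici, moment_Ici, zero_div]
    exact hpos

lemma expectedCost_thresholdPolicy [IsProbabilityMeasure μ] {P : ℝ} (c : ℝ)
    (hp : IsSourceDensity p) (hX : HasDensity μ X p) (hV : IsChannelNoise μ X V) (hP : 0 < P)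
    {b : ℝ} (hb : 0 < b) : expectedCost μ X V P c (thresholdPolicy b) =
      thresholdCost p c (1 / (snr μ V P + 1)) b := by
  have hi := hX.integrable_density hp
  rw [((admissible_thresholdPolicy hp hX hb).cost c hp hX hV hP).2, region₀_thresholdPolicy,
    region₁_one_thresholdPolicy hb, region₁_neg_one_thresholdPolicy hb]
  simp only [thresholdCost, spread, moment_Ici, moment_Iic_neg hp, moment_one_Ioo_neg hp hi hb,
    moment_Ioo_neg hp hi 2 hb]
  ring

end Transfer

end RemoteEstimation

theorem theorem2 {Ω : Type*} [MeasurableSpace Ω] (μ : Measure Ω) [IsProbabilityMeasure μ]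
    (p : ℝ → ℝ) (X V : Ω → ℝ) (P c : ℝ)
    (hp : IsSourceDensity p) (hX : HasDensity μ X p) (hV : IsChannelNoise μ X V)
    (hP : 0 < P) (hc : 0 < c) :
    -- the costs of all admissible policies, threshold policies included, are finite
    (∀ f : ℝ → Fin 2, Admissible μ X f → Integrable (stageCost μ X V P c f) μ) ∧
    (∀ b : ℝ, 0 < b → Admissible μ X (thresholdPolicy b)) ∧
    ∃ β : ℝ, 0 < β ∧
      -- the threshold policy is optimal among all admissible policies
      (∀ f : ℝ → Fin 2, Admissible μ X f →
        expectedCost μ X V P c (thresholdPolicy β) ≤ expectedCost μ X V P c f) ∧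
      -- the optimal threshold is unique
      (∀ b : ℝ, 0 < b → b ≠ β →
        expectedCost μ X V P c (thresholdPolicy β) < expectedCost μ X V P c (thresholdPolicy b)) ∧
      -- it is the unique nonnegative solution of the fixed-point equation
      (∀ b : ℝ, 0 ≤ b →
        (b ^ 2 = meanExcess μ X b ^ 2 / (snr μ V P + 1) + c ↔ b = β)) := by
  have hi := hX.integrable_density hp
  have hγ : 0 < snr μ V P := div_pos hP hV.variance_pos
  have ha : 0 ≤ 1 / (snr μ V P + 1) := by positivity
  have ha' : 1 / (snr μ V P + 1) ≤ 1 := by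
    rw [div_le_one (by linarith)]; linarith
  obtain ⟨β, hβ, hopt, hfix⟩ := exists_optimal_threshold hp hi hc ha
  refine ⟨fun f hf => (hf.cost c hp hX hV hP).1,
    fun b hb => admissible_thresholdPolicy hp hX hb, β, hβ, fun f hf => ?_, fun b hb hne => ?_,
    fun b hb => ?_⟩
  · have hfm := hf.measurable
    have hA₀ := measurableSet_region₀ hfm
    have hA₁ := measurableSet_region₁ hfm 1
    have hA₂ := measurableSet_region₁ hfm (-1)
    have hlt := hf.mean_neg_lt
    have hlt' := hf.mean_lt_pos
    rw [hX.regionMean_eq hp hA₀, hX.regionMean_eq hp hA₂] at hlt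
    rw [hX.regionMean_eq hp hA₀, hX.regionMean_eq hp hA₁] at hlt'
    obtain ⟨w, hw, hle⟩ := exists_thresholdCost_le hp hi hA₀ hA₁ hA₂
      (fun x hx => sign_eq_one_iff.1 hx.2) (fun x hx => sign_eq_neg_one_iff.1 hx.2)
      (moment_regions hp hi hfm) ((hX.moment_zero_pos_iff hp hA₀).1 hf.region₀_pos)
      ((hX.moment_zero_pos_iff hp hA₁).1 hf.region_pos_pos)
      ((hX.moment_zero_pos_iff hp hA₂).1 hf.region_neg_pos) hlt hlt' c ha ha'
    rw [(hf.cost c hp hX hV hP).2, expectedCost_thresholdPolicy c hp hX hV hP hβ]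
    refine le_trans ?_ hle
    rcases eq_or_ne w β with rfl | hne
    · exact le_rfl
    · exact (hopt w hw.le hne).le
  · rw [expectedCost_thresholdPolicy c hp hX hV hP hβ,
      expectedCost_thresholdPolicy c hp hX hV hP hb]
    exact hopt b hb.le hne
  · have e : meanExcess μ X b = excess p b := by
      rw [meanExcess, hX.regionMean_eq hp measurableSet_Ioi, excess]
    rw [← hfix b hb, e, div_eq_inv_mul, ← one_div]
    constructor <;> intro h <;> linarith
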